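/- Let $G=(V,E)$ be a finite simple graph. Let $0\notin V$, let $\widehat{\mathbb S}^V$ be the space of real symmetric matrices indexed by $\{0\}\cup V$ with the trace inner product $\langle\cdot,\cdot\rangle$, let $e_i$ be the standard basis vectors of $\mathbb R^{\{0\}\cup V}$, and put $\operatorname{Sym}(M)=\tfrac12(M+M^{\mathsf T})$. Consider a system $\langle \hat A_i,\hat X\rangle\le b_i$ $(i\in[m])$, $\hat X\succeq 0$, with $\hat A_i\in\widehat{\mathbb S}^V$ and $b\in\mathbb R^m$ (an equation stands for two opposite inequalities, and $\ge$ for the negated inequality), and a linear map $\mathcal L:\mathbb R^k\to\widehat{\mathbb S}^V$. For $c\in\mathbb Z^k$, the dual of $\sup\{\langle\mathcal L(c),\hat X\rangle : \langle\hat A_i,\hat X\rangle\le b_i\ \forall i,\ \hat X\succeq0\}$ is $$\inf\Bigl\{b^{\mathsf T}y : y\in\mathbb R^m_+,\ \hat S=\sum_i y_i\hat A_i-\mathcal L(c)\succeq0\Bigr\}.$$ A dual solution $(y,\hat S)$ is *integral* if $y\in\mathbb Z^m$ and $$\hat S=\sum_{K\subseteq V}m_K\begin{bmatrix}-1\\ \mathbb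 1_K\end{bmatrix}\begin{bmatrix}-1\\ \mathbb 1_K\end{bmatrix}^{\mathsf T}$$ for some nonnegative integers $m_K$, where $\mathbb 1_K\in\{0,1\}^V$ is the incidence vector of $K$. The system is *totally dual integral (TDI) through $\mathcal L$* if, for every $c\in\mathbb Z^k$, the dual has an integral optimal solution whenever it has an optimal solution. Let $(\mathrm B)$ denote the constraints $\langle e_0e_0^{\mathsf T},\hat X\rangle=1$, and $\langle 2\operatorname{Sym}(e_j(e_j-e_0)^{\mathsf T}),\hat X\rangle=0$ and $\langle e_je_j^{\mathsf T},\hat X\rangle\ge0$ for all $j\in V$. The defining systems of the SDP formulations of the Lovász function $\theta$ of $G$ and of its variants $\theta'$ and $\theta^+$ are: - $(\theta)$: $(\mathrm B)$, $\langle2\operatorname{Sym}(e_ie_j^{\mathsf T}),\hat X\rangle=0$ for all $ij\in E$, and $\hat X\succeq0$; - $(\theta')$: the constraints of $(\theta)$ and $\langle2\operatorname{Sym}(e_ie_j^{\mathsf T}),\hat X\rangle\ge0$ for all pairs $ij$ of distinct non-adjacent vertices; - $(\theta^+)$: $(\mathrm B)$, $\langle2\operatorname{Sym}(e_ie_j^{\mathsf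 T}),\hat X\rangle\le0$ for all $ij\in E$, and $\hat X\succeq0$. Then the system $(\theta)$ is TDI through the lifting $w\in\mathbb R^V\mapsto\operatorname{Diag}(0\oplus w)$ if and only if $G$ is perfect, i.e. $\omega(G[U])=\chi(G[U])$ for every $U\subseteq V$. Likewise, the system $(\theta')$ is TDI through this lifting if and only if $G$ is perfect, and the system $(\theta^+)$ is TDI through this lifting if and only if $G$ is perfect. -/

import Mathlib

namespace ThetaTDI

/-- The space `Ŝ^V` of symmetric real matrices on the lifted index set `{0} ∪ V`.
The extra index `0` is `none : Option V`. -/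
def SymHat (V : Type*) : Submodule ℝ (Matrix (Option V) (Option V) ℝ) where
  carrier := {X | X.transpose = X}
  add_mem' := by
    intro X Y hX hY
    change (X + Y).transpose = X + Y
    rw [Matrix.transpose_add, hX, hY]
  zero_mem' := Matrix.transpose_zero
  smul_mem' := by
    intro c X hX
    change (c • X).transpose = c • X
    rw [Matrix.transpose_smul, hX]

/-- A linear system `⟨A i, X⟩ ≤ b i` (`i : ι`) on a variable `X ∈ Ŝ^V`; the semidefinite
system that it defines has the further constraint `X ⪰ 0`. -/
structure SDPSystem (V ι : Type*) where
  A : ι → SymHat V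
  b : ι → ℝ

namespace SDPSystem

variable {V ι κ : Type*}

/-- The constraints `⟨A i, X⟩ ≤ b i`. -/
def le (A : ι → SymHat V) (b : ι → ℝ) : SDPSystem V ι := ⟨A, b⟩

/-- The constraints `⟨A i, X⟩ ≥ b i`. -/
def ge (A : ι → SymHat V) (b : ι → ℝ) : SDPSystem V ι := ⟨fun i => -A i, fun i => -b i⟩

/-- All constraints of two systems together. -/
def append (S : SDPSystem V ι) (T : SDPSystem V κ) : SDPSystem V (ι ⊕ κ) :=
  ⟨Sum.elim S.A T.A, Sum.elim S.b T.b⟩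

/-- The constraints `⟨A i, X⟩ = b i`, as pairs of opposite inequalities. -/
def eq (A : ι → SymHat V) (b : ι → ℝ) : SDPSystem V (ι ⊕ ι) := (le A b).append (ge A b)

/-- Feasibility of `X` in the primal semidefinite program
`sup {⟨C, X⟩ : ⟨A i, X⟩ ≤ b i for all i, X ⪰ 0}`. -/
def PrimalFeasible [Fintype V] (S : SDPSystem V ι) (X : Matrix (Option V) (Option V) ℝ) : Prop :=
  X.PosSemidef ∧ ∀ i, ((S.A i).1 * X.transpose).trace ≤ S.b i

/-- The dual slack `∑ i, y i • A i - C`. -/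
def slack [Fintype ι] (S : SDPSystem V ι) (C : SymHat V) (y : ι → ℝ) : SymHat V :=
  ∑ i, y i • S.A i - C

/-- Feasibility in the dual program `inf {bᵀ y : y ≥ 0, ∑ i, y i • A i - C ⪰ 0}`. -/
def DualFeasible [Fintype ι] (S : SDPSystem V ι) (C : SymHat V) (y : ι → ℝ) : Prop :=
  (∀ i, 0 ≤ y i) ∧ (S.slack C y).1.PosSemidef

/-- Optimality in the dual program. -/
def DualOptimal [Fintype ι] (S : SDPSystem V ι) (C : SymHat V) (y : ι → ℝ) : Prop :=
  S.DualFeasible C y ∧ ∀ y', S.DualFeasible C y' → ∑ i, S.b i * y i ≤ ∑ i, S.b i * y' i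

end SDPSystem

/-- The vector `(-1) ⊕ 𝟙_K` on `{0} ∪ V`. -/
def negIncid {V : Type*} [DecidableEq V] (K : Finset V) : Option V → ℝ
  | none => -1
  | some i => if i ∈ K then 1 else 0

/-- Integrality of a dual slack: `S = ∑_{K ⊆ V} m_K ((-1) ⊕ 𝟙_K) ((-1) ⊕ 𝟙_K)ᵀ` for some
nonnegative integers `m_K`. -/
def IntegralSlack {V : Type*} [Fintype V] [DecidableEq V] (S : SymHat V) : Prop :=
  ∃ m : Finset V → ℕ, S.1 = ∑ K : Finset V, (m K : ℝ) • Matrix.vecMulVec (negIncid K) (negIncid K)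

/-- A dual solution is integral if both the vector `y` and its slack are integral. -/
def IntegralDual {V ι : Type*} [Fintype V] [DecidableEq V] [Fintype ι]
    (S : SDPSystem V ι) (C : SymHat V) (y : ι → ℝ) : Prop :=
  (∀ i, ∃ n : ℤ, y i = n) ∧ IntegralSlack (S.slack C y)

/-- Total dual integrality through the lifting map `L`. -/
def IsTDIThrough {V ι κ : Type*} [Fintype V] [DecidableEq V] [Fintype ι]
    (S : SDPSystem V ι) (L : (κ → ℝ) →ₗ[ℝ] SymHat V) : Prop :=
  ∀ c : κ → ℤ, (∃ y, S.DualOptimal (L fun k => (c k : ℝ)) y) →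
    ∃ y, S.DualOptimal (L fun k => (c k : ℝ)) y ∧ IntegralDual S (L fun k => (c k : ℝ)) y

section Matrices

variable {V : Type*} [DecidableEq V]

/-- The standard basis vector `e_i` of `ℝ^({0} ∪ V)`. -/
def e (i : Option V) : Option V → ℝ := Pi.single i 1

/-- `2 Sym(x yᵀ) = x yᵀ + y xᵀ`. -/
def twoSym (x y : Option V → ℝ) : SymHat V :=
  ⟨Matrix.vecMulVec x y + Matrix.vecMulVec y x, by
    change Matrix.transpose _ = _
    rw [Matrix.transpose_add, Matrix.transpose_vecMulVec, Matrix.transpose_vecMulVec, add_comm]⟩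

/-- `x xᵀ`. -/
def outer (x : Option V → ℝ) : SymHat V :=
  ⟨Matrix.vecMulVec x x, Matrix.transpose_vecMulVec x x⟩

/-- `2 Sym(e_i e_jᵀ)` for an unordered pair `ij` of elements of `V`. -/
def pairMat : Sym2 V → SymHat V :=
  Sym2.lift ⟨fun i j => twoSym (e (some i)) (e (some j)), fun _ _ => Subtype.ext (add_comm _ _)⟩

/-- The lifting map `w ↦ Diag(0 ⊕ w)`. -/
def diagLift : (V → ℝ) →ₗ[ℝ] SymHat V where
  toFun w := ⟨Matrix.diagonal fun i => Option.elim i 0 w, Matrix.diagonal_transpose _⟩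
  map_add' w w' := by
    ext i j
    rcases i with _ | i <;> rcases j with _ | j <;>
      simp [Matrix.diagonal_apply]
    split_ifs <;> simp
  map_smul' c w := by
    ext i j
    rcases i with _ | i <;> rcases j with _ | j <;>
      simp [Matrix.diagonal_apply]

/-- The constraints `⟨e_0 e_0ᵀ, X⟩ = 1`, and `⟨2 Sym(e_j (e_j - e_0)ᵀ), X⟩ = 0` and
`⟨e_j e_jᵀ, X⟩ ≥ 0` for `j ∈ V`. -/
def baseSystem (V : Type*) [DecidableEq V] : SDPSystem V (((Unit ⊕ Unit) ⊕ (V ⊕ V)) ⊕ V) :=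
  ((SDPSystem.eq (fun _ : Unit => outer (e none)) (fun _ => 1)).append
    (SDPSystem.eq (fun j : V => twoSym (e (some j)) (e (some j) - e none)) (fun _ => 0))).append
    (SDPSystem.ge (fun j : V => outer (e (some j))) (fun _ => 0))

/-- The defining system of the formulation of `θ(G; w)`: additionally
`⟨2 Sym(e_i e_jᵀ), X⟩ = 0` for the edges `ij`. -/
def thetaSystem (G : SimpleGraph V) :
    SDPSystem V ((((Unit ⊕ Unit) ⊕ (V ⊕ V)) ⊕ V) ⊕ (G.edgeSet ⊕ G.edgeSet)) :=
  (baseSystem V).append (SDPSystem.eq (fun ij : G.edgeSet => pairMat ij.1) (fun _ => 0))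

/-- The defining system of the formulation of `θ'(G; w)`: that of `θ` with additionally
`⟨2 Sym(e_i e_jᵀ), X⟩ ≥ 0` for the pairs `ij` of distinct non-adjacent vertices. -/
def thetaPrimeSystem (G : SimpleGraph V) :
    SDPSystem V (((((Unit ⊕ Unit) ⊕ (V ⊕ V)) ⊕ V) ⊕ (G.edgeSet ⊕ G.edgeSet)) ⊕ Gᶜ.edgeSet) :=
  (thetaSystem G).append (SDPSystem.ge (fun ij : Gᶜ.edgeSet => pairMat ij.1) (fun _ => 0))

/-- The defining system of the formulation of `θ⁺(G; w)`: `⟨2 Sym(e_i e_jᵀ), X⟩ ≤ 0` for the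
edges `ij`. -/
def thetaPlusSystem (G : SimpleGraph V) :
    SDPSystem V ((((Unit ⊕ Unit) ⊕ (V ⊕ V)) ⊕ V) ⊕ G.edgeSet) :=
  (baseSystem V).append (SDPSystem.le (fun ij : G.edgeSet => pairMat ij.1) (fun _ => 0))

end Matrices

/-- `G` is perfect: `ω(G[U]) = χ(G[U])` for every set `U` of vertices. -/
def IsPerfect {V : Type*} (G : SimpleGraph V) : Prop :=
  ∀ U : Set V, ((G.induce U).cliqueNum : ℕ∞) = (G.induce U).chromaticNumber

end ThetaTDI

namespace ThetaTDI

open Finset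

/-! ### Weighted perfection: replication and the perfect graph theorem. -/

section Covers

variable {V : Type*} [Fintype V] [DecidableEq V]

/-- `m` is a cover of the weights `w` by cliques of `H`, `m K` being the multiplicity of `K`. -/
def IsCliqueCover (H : SimpleGraph V) (w : V → ℕ) (m : Finset V → ℕ) : Prop :=
  (∀ K : Finset V, m K ≠ 0 → H.IsClique K) ∧ ∀ v, w v ≤ ∑ K with v ∈ K, m K

/-- The weighted form of perfection: the maximum weight of a clique is the minimum size of a
cover of the weights by stable sets. -/
def WeightedPerfect (H : SimpleGraph V) : Prop :=
  ∀ w : V → ℕ, ∃ K : Finset V, H.IsClique K ∧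
    ∃ m, IsCliqueCover Hᶜ w m ∧ ∑ S, m S ≤ ∑ v ∈ K, w v

theorem card_inter_le_one {V : Type*} [DecidableEq V] {H : SimpleGraph V} {S K : Finset V}
    (hS : Hᶜ.IsClique S) (hK : H.IsClique K) : #(S ∩ K) ≤ 1 := by
  rw [card_le_one]
  intro a ha b hb
  rw [mem_inter] at ha hb
  by_contra hab
  exact (hS ha.1 hb.1 hab).2 (hK ha.2 hb.2 hab)

theorem sum_mul_coverage (m : Finset V → ℕ) (w : V → ℕ) :
    ∑ v, w v * ∑ S with v ∈ S, m S = ∑ S, m S * ∑ v ∈ S, w v := by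
  simp_rw [mul_sum, sum_filter]
  rw [sum_comm]
  refine sum_congr rfl fun S _ => ?_
  rw [← sum_filter]
  simp [mul_comm]

theorem sum_coverage (m : Finset V → ℕ) (K : Finset V) :
    ∑ v ∈ K, ∑ S with v ∈ S, m S = ∑ S, m S * #(S ∩ K) := by
  simp_rw [sum_filter]
  rw [sum_comm]
  refine sum_congr rfl fun S _ => ?_
  rw [← sum_filter, sum_const, smul_eq_mul, mul_comm, inter_comm, filter_mem_eq_inter]

theorem IsCliqueCover.add_single {H : SimpleGraph V} {w w' : V → ℕ} {m : Finset V → ℕ}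
    (hm : IsCliqueCover H w m) {S : Finset V} (hS : H.IsClique S)
    (hw : ∀ v, w' v ≤ w v + if v ∈ S then 1 else 0) :
    IsCliqueCover H w' (m + Pi.single S 1) := by
  refine ⟨fun K hK => ?_, fun v => ?_⟩
  · by_cases h : K = S
    · rwa [h]
    · apply hm.1
      simpa [Pi.single_apply, h] using hK
  · have h1 := hm.2 v
    have h2 : ∑ K with v ∈ K, (Pi.single S 1 : Finset V → ℕ) K = if v ∈ S then 1 else 0 := by
      simp [Pi.single_apply]
    simp only [Pi.add_apply, sum_add_distrib]
    rw [h2]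
    exact (hw v).trans (by omega)

theorem sum_add_single (m : Finset V → ℕ) (S : Finset V) :
    ∑ K, (m + Pi.single S 1 : Finset V → ℕ) K = ∑ K, m K + 1 := by
  simp [sum_add_distrib]

theorem isCliqueCover_zero {H : SimpleGraph V} {w : V → ℕ} (hw : ∀ v, w v = 0) :
    IsCliqueCover H w 0 :=
  ⟨fun _ h => absurd rfl h, fun v => by simp [hw v]⟩

theorem exists_max_weight_clique (H : SimpleGraph V) (w : V → ℕ) :
    ∃ K : Finset V, H.IsClique K ∧
      ∀ K' : Finset V, H.IsClique K' → ∑ v ∈ K', w v ≤ ∑ v ∈ K, w v := by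
  classical
  obtain ⟨K, hK, hmax⟩ := exists_max_image (univ.filter fun K : Finset V => H.IsClique K)
    (fun K => ∑ v ∈ K, w v) ⟨∅, by simp⟩
  exact ⟨K, (mem_filter.1 hK).2, fun K' hK' => hmax K' (mem_filter.2 ⟨mem_univ _, hK'⟩)⟩

/-- In a weighted perfect graph some clique meets all stable sets of maximum weight. -/
theorem WeightedPerfect.exists_clique_meeting {H : SimpleGraph V} (hH : WeightedPerfect H)
    (w : V → ℕ) {n : ℕ}
    (hw : ∀ T : Finset V, Hᶜ.IsClique T → ∑ v ∈ T, w v ≤ n + 1) :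
    ∃ K : Finset V, H.IsClique K ∧ ∀ T : Finset V, Hᶜ.IsClique T → ∑ v ∈ T, w v = n + 1 →
      ∃ v ∈ K, v ∈ T ∧ w v ≠ 0 := by
  classical
  by_contra! hcon
  have hcon' : ∀ K : Finset V, ∃ T : Finset V, H.IsClique K →
      (Hᶜ.IsClique T ∧ ∑ v ∈ T, w v = n + 1 ∧ #(K ∩ T) = 0) := by
    intro K
    by_cases hK : H.IsClique K
    · obtain ⟨T, hT, hTw, hT0⟩ := hcon K hK
      -- Dropping the vertices of weight zero keeps the weight of `T` and makes it disjoint from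
      -- `K`.
      refine ⟨T.filter fun v => w v ≠ 0, fun _ =>
        ⟨hT.subset (coe_subset.2 (filter_subset _ _)), ?_, ?_⟩⟩
      · rw [sum_filter_ne_zero, hTw]
      · rw [card_eq_zero, eq_empty_iff_forall_notMem]
        intro v hv
        simp only [mem_inter, mem_filter] at hv
        exact hv.2.2 (hT0 v hv.1 hv.2.1)
    · exact ⟨∅, fun h => absurd h hK⟩
  choose T hT using hcon'
  set C : Finset (Finset V) := univ.filter fun K : Finset V => H.IsClique K with hC
  have hCmem : ∀ {K}, K ∈ C ↔ H.IsClique K := by simp [hC]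
  -- Each vertex is weighted by the number of cliques `K` with `v ∈ T K`. A clique `K₀` meets each
  -- `T K` at most once and misses `T K₀`, so fewer than `#C` stable sets cover these weights.
  -- Counted with `w`, the sets `T K` weigh `#C * (n + 1)` in total, while each covering set weighs
  -- at most `n + 1`: a contradiction.
  obtain ⟨K₀, hK₀, m, hm, hmK⟩ := hH fun v => ∑ K ∈ C, if v ∈ T K then 1 else 0
  have hlt : ∑ S, m S < #C := by
    refine hmK.trans_lt ?_
    rw [sum_comm, card_eq_sum_ones]
    refine sum_lt_sum (fun K hK => ?_) ⟨K₀, hCmem.2 hK₀, ?_⟩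
    · rw [← sum_filter, sum_const, smul_eq_mul, mul_one, filter_mem_eq_inter, inter_comm]
      exact card_inter_le_one (hT K (hCmem.1 hK)).1 hK₀
    · rw [← sum_filter, sum_const, smul_eq_mul, mul_one, filter_mem_eq_inter,
        (hT K₀ hK₀).2.2]
      exact one_pos
  have h1 : ∑ v, w v * ∑ K ∈ C, (if v ∈ T K then 1 else 0) = #C * (n + 1) := by
    simp_rw [mul_sum]
    rw [sum_comm, ← smul_eq_mul, ← sum_const]
    refine sum_congr rfl fun K hK => ?_
    rw [← (hT K (hCmem.1 hK)).2.1]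
    simp
  have h2 : ∑ v, w v * ∑ K ∈ C, (if v ∈ T K then 1 else 0) ≤ (∑ S, m S) * (n + 1) := by
    calc _ ≤ ∑ v, w v * ∑ S with v ∈ S, m S :=
          sum_le_sum fun v _ => Nat.mul_le_mul_left _ (hm.2 v)
      _ = ∑ S, m S * ∑ v ∈ S, w v := sum_mul_coverage m w
      _ ≤ ∑ S, m S * (n + 1) := by
          refine sum_le_sum fun S _ => ?_
          by_cases hS : m S = 0
          · simp [hS]
          · exact Nat.mul_le_mul_left _ (hw S (hm.1 S hS))
      _ = _ := by rw [sum_mul]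
  rw [h1] at h2
  exact absurd (Nat.le_of_mul_le_mul_right h2 n.succ_pos) (not_le.2 hlt)

/-- The weighted form of the perfect graph theorem. -/
theorem WeightedPerfect.compl {H : SimpleGraph V} (hH : WeightedPerfect H) :
    WeightedPerfect Hᶜ := by
  have key : ∀ n : ℕ, ∀ w : V → ℕ,
      (∀ T : Finset V, Hᶜ.IsClique T → ∑ v ∈ T, w v ≤ n) →
      ∃ m, IsCliqueCover H w m ∧ ∑ S, m S ≤ n := by
    intro n
    induction n with
    | zero =>
      intro w hw
      refine ⟨0, isCliqueCover_zero fun v => ?_, by simp⟩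
      simpa using hw {v} (by simp)
    | succ n ih =>
      intro w hw
      obtain ⟨K, hK, hKT⟩ := hH.exists_clique_meeting w hw
      -- Lowering the weights by one on `K` lowers every stable set of weight `n + 1`, as `K` meets
      -- it in a vertex of positive weight.
      obtain ⟨m, hm, hmn⟩ := ih (fun v => w v - if v ∈ K then 1 else 0) fun T hT => by
        by_cases hTw : ∑ v ∈ T, w v = n + 1
        · obtain ⟨v, hvK, hvT, hv⟩ := hKT T hT hTw
          rw [← Nat.lt_succ_iff, Nat.succ_eq_add_one, ← hTw]
          refine sum_lt_sum (fun u _ => Nat.sub_le _ _) ⟨v, hvT, ?_⟩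
          simp only [hvK, if_true]
          omega
        · have h1 := hw T hT
          have h2 : ∑ v ∈ T, (w v - if v ∈ K then 1 else 0) ≤ ∑ v ∈ T, w v :=
            sum_le_sum fun u _ => Nat.sub_le _ _
          omega
      refine ⟨_, hm.add_single hK fun v => by omega, ?_⟩
      rw [sum_add_single]
      omega
  intro w
  obtain ⟨K, hK, hmax⟩ := exists_max_weight_clique Hᶜ w
  obtain ⟨m, hm, hmn⟩ := key _ w hmax
  exact ⟨K, hK, m, by rwa [compl_compl], hmn⟩

/-- The replication argument: covers of incidence vectors suffice for weighted perfection. -/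
theorem weightedPerfect_of_finset {H : SimpleGraph V}
    (hH : ∀ U : Finset V, ∃ K ⊆ U, H.IsClique K ∧
      ∃ m, IsCliqueCover Hᶜ (fun v => if v ∈ U then 1 else 0) m ∧ ∑ S, m S ≤ #K) :
    WeightedPerfect H := by
  have key : ∀ n : ℕ, ∀ w : V → ℕ, ∑ v, w v = n → ∀ k,
      (∀ K : Finset V, H.IsClique K → ∑ v ∈ K, w v ≤ k) →
      ∃ m, IsCliqueCover Hᶜ w m ∧ ∑ S, m S ≤ k := by
    intro n
    induction n using Nat.strong_induction_on with
    | _ n ih =>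
    intro w hwn k hk
    by_cases h2 : ∃ v, 2 ≤ w v
    · obtain ⟨v, hv⟩ := h2
      -- One copy of `v` is removed. Another remains, so a cover of `w'` uses some `S` containing
      -- `v`; this `S` will also cover the removed copy.
      set w' : V → ℕ := fun u => w u - if u = v then 1 else 0 with hw'
      have hw'le : ∀ u, w' u ≤ w u := fun u => Nat.sub_le _ _
      have hw'lt : ∑ u, w' u < n := by
        rw [← hwn]
        refine sum_lt_sum (fun u _ => hw'le u) ⟨v, mem_univ _, ?_⟩
        simp only [hw', if_true]
        omega
      obtain ⟨m, hm, hmk⟩ := ih _ hw'lt w' rfl k fun K hK =>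
        (sum_le_sum fun u _ => hw'le u).trans (hk K hK)
      have hvcov : ∑ S with v ∈ S, m S ≠ 0 := by
        have := hm.2 v
        simp only [hw', if_true] at this
        omega
      obtain ⟨S, hvS, hmS⟩ := exists_ne_zero_of_sum_ne_zero hvcov
      rw [mem_filter] at hvS
      have hkpos : 1 ≤ k := by
        have := hk {v} (by simp)
        rw [sum_singleton] at this
        omega
      -- The remaining copies of `v` stay in `w''`, since `S` is spent on the removed one. It
      -- suffices that no clique has `w''`-weight `k`.
      set w'' : V → ℕ := fun u => w' u - if u ∈ S.erase v then 1 else 0 with hw''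
      have hw''le : ∀ u, w'' u ≤ w' u := fun u => Nat.sub_le _ _
      obtain ⟨m', hm', hmk'⟩ := ih _ ((sum_le_sum fun u _ => hw''le u).trans_lt hw'lt) w'' rfl
        (k - 1) fun K hK => by
          by_cases hKw : ∑ u ∈ K, w' u = k
          -- A clique of `w'`-weight `k` makes the cover tight, so every set used, `S` among them,
          -- meets its positive part. The common vertex is not `v`, for otherwise `K` would have
          -- `w`-weight above `k`.
          · have hmeet : ∃ u ∈ K, u ∈ S ∧ w' u ≠ 0 := by
              by_contra! hno
              have hK' : H.IsClique (K.filter fun u => w' u ≠ 0 : Finset V) :=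
                hK.subset (coe_subset.2 (filter_subset _ _))
              have h3 : k ≤ ∑ T, m T * #(T ∩ K.filter fun u => w' u ≠ 0) := by
                rw [← sum_coverage, ← hKw, ← sum_filter_ne_zero]
                exact sum_le_sum fun u _ => hm.2 u
              have h4 : ∑ T, m T * #(T ∩ K.filter fun u => w' u ≠ 0) < ∑ T, m T := by
                refine sum_lt_sum (fun T _ => ?_) ⟨S, mem_univ _, ?_⟩
                · by_cases hT : m T = 0
                  · simp [hT]
                  · calc _ ≤ m T * 1 := Nat.mul_le_mul_left _ (card_inter_le_one (hm.1 T hT) hK')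
                      _ = m T := mul_one _
                · have : S ∩ K.filter (fun u => w' u ≠ 0) = ∅ := by
                    rw [eq_empty_iff_forall_notMem]
                    intro u hu
                    simp only [mem_inter, mem_filter] at hu
                    exact hu.2.2 (hno u hu.2.1 hu.1)
                  rw [this]
                  simpa using Nat.pos_of_ne_zero hmS
              omega
            obtain ⟨u, huK, huS, hu⟩ := hmeet
            have huv : u ≠ v := by
              rintro rfl
              have h5 : ∑ x ∈ K, w' x < ∑ x ∈ K, w x := by
                refine sum_lt_sum (fun x _ => hw'le x) ⟨u, huK, ?_⟩
                simp only [hw', if_true]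
                omega
              have := hk K hK
              omega
            have : ∑ x ∈ K, w'' x < ∑ x ∈ K, w' x := by
              refine sum_lt_sum (fun x _ => hw''le x) ⟨u, huK, ?_⟩
              simp only [hw'', mem_erase, huv, huS, ne_eq, not_false_eq_true, and_self, if_true]
              omega
            omega
          · have h5 : ∑ x ∈ K, w' x ≤ ∑ x ∈ K, w x := sum_le_sum fun x _ => hw'le x
            have h6 : ∑ x ∈ K, w'' x ≤ ∑ x ∈ K, w' x := sum_le_sum fun x _ => hw''le x
            have := hk K hK
            omega
      refine ⟨_, hm'.add_single (hm.1 S hmS) fun u => ?_, ?_⟩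
      · simp only [hw'', hw', mem_erase]
        by_cases huv : u = v
        · subst huv
          simp only [hvS.2, if_true, ne_eq, not_true, false_and, if_false]
          omega
        · by_cases huS : u ∈ S
          · simp only [huv, huS, if_true, ne_eq, not_false_eq_true, and_self, if_false]
            omega
          · simp only [huv, huS, and_false, if_false]
            omega
      · rw [sum_add_single]
        omega
    · push Not at h2
      obtain ⟨K, hKU, hK, m, hm, hmK⟩ := hH (univ.filter fun v => w v ≠ 0)
      have hw : ∀ v, w v = if v ∈ univ.filter (fun v => w v ≠ 0) then 1 else 0 := by
        intro v
        have := h2 v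
        simp only [mem_filter, mem_univ, true_and]
        split_ifs <;> omega
      refine ⟨m, by rwa [← funext hw] at hm, hmK.trans ((le_of_eq ?_).trans (hk K hK))⟩
      rw [card_eq_sum_ones]
      refine sum_congr rfl fun v hv => ?_
      rw [hw v, if_pos (hKU hv)]
  intro w
  obtain ⟨K, hK, hmax⟩ := exists_max_weight_clique H w
  exact ⟨K, hK, key _ w rfl _ hmax⟩

/-- Perfection implies its weighted form. -/
theorem IsPerfect.weightedPerfect {G : SimpleGraph V} (hG : IsPerfect G) :
    WeightedPerfect G := by
  classical
  refine weightedPerfect_of_finset fun U => ?_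
  obtain ⟨s, hs⟩ := (G.induce (U : Set V)).exists_isNClique_cliqueNum
  obtain ⟨C⟩ := SimpleGraph.chromaticNumber_le_iff_colorable.1 (hG (U : Set V)).ge
  let T : Fin (G.induce (U : Set V)).cliqueNum → Finset V := fun c =>
    univ.filter fun v => ∃ h : v ∈ (U : Set V), C ⟨v, h⟩ = c
  -- Several colours may have the empty class, so the multiplicity of `S` counts colours; the total
  -- is then the number of colours.
  refine ⟨s.map (Function.Embedding.subtype _), ?_, ?_, fun S => #{c | T c = S}, ⟨?_, ?_⟩, ?_⟩
  · intro v hv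
    obtain ⟨u, -, rfl⟩ := mem_map.1 hv
    exact u.2
  · have := hs.isClique
    rw [SimpleGraph.isClique_induce_iff] at this
    simpa using this
  · intro S hS u hu v hv huv
    obtain ⟨c, hc⟩ := card_ne_zero.1 hS
    rw [mem_filter] at hc
    rw [← hc.2] at hu hv
    simp only [T, coe_filter, mem_univ, true_and, Set.mem_ofPred_eq] at hu hv
    obtain ⟨hu, huc⟩ := hu
    obtain ⟨hv, hvc⟩ := hv
    rw [SimpleGraph.compl_adj]
    refine ⟨huv, fun hadj => ?_⟩
    exact C.valid (v := ⟨u, hu⟩) (w := ⟨v, hv⟩) (by simpa using hadj) (huc.trans hvc.symm)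
  · intro v
    dsimp only
    split_ifs with hv
    · have hmem : T (C ⟨v, hv⟩) ∈ univ.filter fun S : Finset V => v ∈ S :=
        mem_filter.2 ⟨mem_univ _, mem_filter.2 ⟨mem_univ _, hv, rfl⟩⟩
      refine le_trans ?_ (single_le_sum (f := fun S => #{c | T c = S})
        (fun _ _ => Nat.zero_le _) hmem)
      exact card_pos.2 ⟨C ⟨v, hv⟩, by simp⟩
    · exact Nat.zero_le _
  · rw [card_map, hs.card_eq, ← card_eq_sum_card_fiberwise (f := T) (s := univ) (t := univ)
      (fun _ _ => by simp)]
    simp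

/-- The weighted form of perfection implies perfection. -/
theorem WeightedPerfect.isPerfect {G : SimpleGraph V} (hG : WeightedPerfect G) :
    IsPerfect G := by
  classical
  intro U
  apply le_antisymm
  · obtain ⟨s, hs⟩ := (G.induce U).exists_isNClique_cliqueNum
    rw [← hs.card_eq]
    exact hs.isClique.card_le_chromaticNumber
  · obtain ⟨K, hK, m, hm, hmK⟩ := hG fun v => if v ∈ U then 1 else 0
    have hcov : ∀ v : U, ∃ S : Finset V, m S ≠ 0 ∧ (v : V) ∈ S := by
      intro v
      have h1 := hm.2 v
      simp only [v.2, if_true] at h1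
      obtain ⟨S, hS, hmS⟩ := exists_ne_zero_of_sum_ne_zero (Nat.one_le_iff_ne_zero.1 h1)
      exact ⟨S, hmS, (mem_filter.1 hS).2⟩
    choose S hS hvS using hcov
    -- Each vertex is coloured by one stable set of the cover that contains it.
    let C : (G.induce U).Coloring {S : Finset V // m S ≠ 0} :=
      SimpleGraph.Coloring.mk (fun v => ⟨S v, hS v⟩) fun {u v} huv h => by
        have hSS : S u = S v := congrArg Subtype.val h
        have hu := hvS u
        rw [hSS] at hu
        exact (hm.1 _ (hS v) hu (hvS v) (fun h => huv.ne (Subtype.ext h))).2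
          (by simpa using huv)
    rw [SimpleGraph.chromaticNumber_le_iff_colorable]
    refine C.colorable.mono ?_
    calc Fintype.card {S : Finset V // m S ≠ 0} = ∑ S with m S ≠ 0, 1 := by
          rw [Fintype.card_subtype, card_eq_sum_ones]
      _ ≤ ∑ S with m S ≠ 0, m S :=
          sum_le_sum fun S hS => Nat.one_le_iff_ne_zero.2 (mem_filter.1 hS).2
      _ = ∑ S, m S := sum_filter_ne_zero _
      _ ≤ _ := hmK
      _ = #(K.subtype (· ∈ U)) := by rw [card_subtype, card_filter]
      _ ≤ _ := by
          refine SimpleGraph.IsClique.card_le_cliqueNum (tc := ?_)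
          rw [SimpleGraph.isClique_induce_iff]
          refine hK.subset ?_
          rintro _ ⟨v, hv, rfl⟩
          simpa using hv

end Covers

/-! ### Sublinear functionals on integer weights. -/

section Sublinear

variable {V : Type*}

/-- A monotone, subadditive and homogeneous functional on the integer weights. -/
structure IsSublinear (f : (V → ℕ) → ℕ) : Prop where
  mono : Monotone f
  subadd : ∀ u v, f (u + v) ≤ f u + f v
  homog : ∀ (k : ℕ) u, f (k • u) = k * f u

/-- A sublinear functional dominates one that is additive along a given vector, and as
additive as before along all others. -/
theorem IsSublinear.exists_additive_along {f : (V → ℕ) → ℕ} (hf : IsSublinear f) (a : V → ℕ) :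
    ∃ g, IsSublinear g ∧ (∀ u, g u ≤ f u) ∧ (∀ u, g (u + a) = g u + f a) ∧
      ∀ b, (∀ u, f (u + b) = f u + f b) → ∀ u, g (u + b) = g u + f b := by
  -- The new functional is the limit of `f (N • a + u) - N * f a`. By subadditivity this is a
  -- nonincreasing sequence of natural numbers, so it is eventually constant, and each property of
  -- `g` is read off at one large `N`.
  have hex : ∀ u, ∃ c N₀, ∀ N, N₀ ≤ N → f (N • a + u) = N * f a + c := by
    intro u
    have hlow : ∀ N, N * f a ≤ f (N • a + u) := fun N => by
      rw [← hf.homog]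
      exact hf.mono (by simp)
    have hanti : Antitone fun N => f (N • a + u) - N * f a := by
      refine antitone_nat_of_succ_le fun N => ?_
      have h1 : f ((N + 1) • a + u) ≤ f (N • a + u) + f a := by
        rw [succ_nsmul, add_right_comm]
        exact hf.subadd _ _
      have h2 : (N + 1) * f a = N * f a + f a := by ring
      have := hlow N
      omega
    obtain ⟨N₀, hN₀⟩ := WellFoundedLT.antitone_chain_condition hanti
    refine ⟨f (N₀ • a + u) - N₀ * f a, N₀, fun N hN => ?_⟩
    have h1 := hN₀ N hN
    have h2 := hlow N
    omega
  choose g B hg using hex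
  refine ⟨g, ⟨fun u v huv => ?_, fun u v => ?_, fun k u => ?_⟩, fun u => ?_, fun u => ?_,
    fun b hb u => ?_⟩
  · have h1 := hg u (max (B u) (B v)) (le_max_left _ _)
    have h2 := hg v (max (B u) (B v)) (le_max_right _ _)
    have h3 := hf.mono (add_le_add_right huv (max (B u) (B v) • a))
    omega
  · set N := B u + B v + B (u + v)
    have h1 := hg u N (by omega)
    have h2 := hg v N (by omega)
    have h3 := hg (u + v) (N + N) (by omega)
    have h4 := hf.subadd (N • a + u) (N • a + v)
    rw [add_add_add_comm, ← add_nsmul, h3, h1, h2, add_mul] at h4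
    omega
  · rcases Nat.eq_zero_or_pos k with rfl | hk
    · have h1 := hg 0 _ le_rfl
      rw [add_zero, hf.homog] at h1
      rw [zero_smul]
      omega
    · set N := B u + B (k • u)
      have h1 := hg u N (by omega)
      have h2 := hg (k • u) (k * N) (le_trans (by omega) (Nat.le_mul_of_pos_left N hk))
      rw [mul_smul, ← smul_add, hf.homog, h1, mul_add, ← mul_assoc] at h2
      omega
  · have h1 := hg u _ le_rfl
    have h2 := hf.subadd (B u • a) u
    rw [hf.homog] at h2
    omega
  · set N := B u + B (u + a)
    have h1 := hg u (N + 1) (by omega)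
    have h2 := hg (u + a) N (by omega)
    rw [succ_nsmul, add_assoc, add_comm a u, h2, add_mul N 1, one_mul] at h1
    omega
  · set N := B u + B (u + b)
    have h1 := hg u N (by omega)
    have h2 := hg (u + b) N (by omega)
    rw [← add_assoc, hb, h1] at h2
    omega

/-- A discrete Hahn–Banach theorem: a sublinear functional on integer weights is the maximum of
the integral linear functionals that it dominates. -/
theorem IsSublinear.exists_linear [Fintype V] [DecidableEq V] {f : (V → ℕ) → ℕ}
    (hf : IsSublinear f) (w : V → ℕ) :
    ∃ g : V → ℕ, (∀ u, ∑ v, u v * g v ≤ f u) ∧ ∑ v, w v * g v = f w := by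
  -- Additivity along `w` is imposed first, which fixes the value `f w`; the unit vectors then
  -- follow one at a time without disturbing it.
  have key : ∀ s : Finset V, ∃ h, IsSublinear h ∧ (∀ u, h u ≤ f u) ∧
      (∀ u, h (u + w) = h u + f w) ∧
      ∀ v ∈ s, ∀ u, h (u + Pi.single v 1) = h u + h (Pi.single v 1) := by
    intro s
    induction s using Finset.induction_on with
    | empty =>
      obtain ⟨h, hh, hle, hw, -⟩ := hf.exists_additive_along w
      exact ⟨h, hh, hle, hw, by simp⟩
    | insert v s hv ih =>
      obtain ⟨h, hh, hle, hw, hs⟩ := ih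
      obtain ⟨g, hg, hgle, hgv, hgb⟩ := hh.exists_additive_along (Pi.single v 1)
      have zero_of : ∀ {k : (V → ℕ) → ℕ}, IsSublinear k → k 0 = 0 := fun hk => by
        simpa using hk.homog 0 0
      have hhw : h w = f w := by simpa [zero_of hh] using hw 0
      refine ⟨g, hg, fun u => (hgle u).trans (hle u), fun u => ?_, fun x hx u => ?_⟩
      · rw [← hhw]
        exact hgb w (fun u => by rw [hw, hhw]) u
      · rw [mem_insert] at hx
        have hadd : ∀ u, g (u + Pi.single x 1) = g u + h (Pi.single x 1) := by
          rcases hx with rfl | hx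
          · exact hgv
          · exact hgb _ (hs x hx)
        have h0 := hadd 0
        rw [zero_add, zero_of hg, zero_add] at h0
        rw [hadd, h0]
  obtain ⟨h, hh, hle, hw, hs⟩ := key univ
  have h0 : h 0 = 0 := by simpa using hh.homog 0 0
  have hsmul : ∀ v k u, h (u + Pi.single v k) = h u + k * h (Pi.single v 1) := by
    intro v k
    induction k with
    | zero => simp
    | succ k ih =>
      intro u
      rw [Pi.single_add, ← add_assoc, hs v (mem_univ _), ih]
      ring
  have hlin : ∀ u : V → ℕ, h u = ∑ v, u v * h (Pi.single v 1) := by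
    intro u
    have : ∀ s : Finset V, h (∑ v ∈ s, Pi.single v (u v)) = ∑ v ∈ s, u v * h (Pi.single v 1) := by
      intro s
      induction s using Finset.induction_on with
      | empty => simpa using h0
      | insert v s hv ih => rw [sum_insert hv, sum_insert hv, add_comm, hsmul, ih, add_comm]
    rw [← this, univ_sum_single]
  refine ⟨fun v => h (Pi.single v 1), fun u => by rw [← hlin]; exact hle u, ?_⟩
  rw [← hlin]
  simpa [h0] using hw 0

end Sublinear

/-! ### Dual solutions as slack matrices: clique covers, weak duality, attainment. -/

section Slacks

variable {V : Type*}

/-- The slacks of the dual program with objective `Diag(0 ⊕ c)`, where `C i j` is the condition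
on the entry at the pair `ij`. -/
structure IsDualSlack (C : V → V → ℝ → Prop) (c : V → ℝ)
    (S : Matrix (Option V) (Option V) ℝ) : Prop where
  posSemidef : S.PosSemidef
  le_diag : ∀ j, c j ≤ -2 * S none (some j) - S (some j) (some j)
  offDiag : ∀ i j, i ≠ j → C i j (S (some i) (some j))

variable [Fintype V] [DecidableEq V]

/-- The matrix `∑ K, m K ((-1) ⊕ 𝟙_K) ((-1) ⊕ 𝟙_K)ᵀ`. -/
noncomputable def coverSlack (m : Finset V → ℝ) : Matrix (Option V) (Option V) ℝ :=
  ∑ K : Finset V, m K • Matrix.vecMulVec (negIncid K) (negIncid K)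

theorem coverSlack_apply (m : Finset V → ℝ) (i j : Option V) :
    coverSlack m i j = ∑ K, m K * (negIncid K i * negIncid K j) := by
  simp [coverSlack, Matrix.sum_apply, Matrix.vecMulVec_apply]

theorem coverSlack_none_none (m : Finset V → ℝ) : coverSlack m none none = ∑ K, m K := by
  simp [coverSlack_apply, negIncid]

theorem coverSlack_none_some (m : Finset V → ℝ) (j : V) :
    coverSlack m none (some j) = -∑ K with j ∈ K, m K := by
  rw [coverSlack_apply, sum_filter, ← sum_neg_distrib]
  refine sum_congr rfl fun K _ => ?_
  by_cases h : j ∈ K <;> simp [negIncid, h]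

theorem coverSlack_some_some (m : Finset V → ℝ) (i j : V) :
    coverSlack m (some i) (some j) = ∑ K with i ∈ K ∧ j ∈ K, m K := by
  simp [coverSlack_apply, negIncid, sum_filter, ← ite_and, and_comm]

theorem coverSlack_diag (m : Finset V → ℝ) (j : V) :
    coverSlack m (some j) (some j) = ∑ K with j ∈ K, m K := by
  simp [coverSlack_some_some]

theorem posSemidef_coverSlack {m : Finset V → ℝ} (hm : ∀ K, 0 ≤ m K) :
    (coverSlack m).PosSemidef := by
  refine Matrix.posSemidef_sum _ fun K _ => Matrix.PosSemidef.smul ?_ (hm K)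
  simpa using Matrix.posSemidef_vecMulVec_self_star (negIncid K)

/-- The entry conditions are compatible with the graph: they are closed, admit `0` everywhere
and nonnegative entries at the edges, and exclude positive entries at the non-edges. -/
structure Compatible (G : SimpleGraph V) (C : V → V → ℝ → Prop) : Prop where
  closed : ∀ i j, IsClosed {s | C i j s}
  zero : ∀ i j, C i j 0
  of_adj : ∀ i j s, G.Adj i j → 0 ≤ s → C i j s
  nonpos : ∀ i j s, i ≠ j → ¬ G.Adj i j → C i j s → s ≤ 0

variable {G : SimpleGraph V} {C : V → V → ℝ → Prop} {c : V → ℝ}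

/-- A fractional clique cover is a dual solution. -/
theorem isDualSlack_coverSlack (hC : Compatible G C) {m : Finset V → ℝ} (hm : ∀ K, 0 ≤ m K)
    (hclique : ∀ K : Finset V, m K ≠ 0 → G.IsClique K) (hcov : ∀ j, c j ≤ ∑ K with j ∈ K, m K) :
    IsDualSlack C c (coverSlack m) where
  posSemidef := posSemidef_coverSlack hm
  le_diag j := by
    rw [coverSlack_none_some, coverSlack_diag]
    linarith [hcov j]
  offDiag i j hij := by
    rw [coverSlack_some_some]
    by_cases hadj : G.Adj i j
    · exact hC.of_adj i j _ hadj (sum_nonneg fun K _ => hm K)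
    · rw [sum_eq_zero]
      · exact hC.zero i j
      · intro K hK
        by_contra h
        rw [mem_filter] at hK
        exact hadj (hclique K h hK.2.1 hK.2.2 hij)

/-- An integral dual solution is a clique cover. -/
theorem isCliqueCover_of_isDualSlack (hC : Compatible G C) {w : V → ℕ} {m : Finset V → ℕ}
    (hS : IsDualSlack C (fun v => (w v : ℝ)) (coverSlack fun K => (m K : ℝ))) :
    IsCliqueCover G w m := by
  refine ⟨fun K hK i hi j hj hij => ?_, fun j => ?_⟩
  · by_contra hadj
    have h1 := hC.nonpos i j _ hij hadj (hS.offDiag i j hij)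
    rw [coverSlack_some_some] at h1
    -- The entry at `ij` is the total multiplicity of the sets containing both, hence at least `m
    -- K`; at a non-edge it may not be positive.
    have h2 := single_le_sum (f := fun K : Finset V => (m K : ℝ)) (fun _ _ => Nat.cast_nonneg _)
      (show K ∈ univ.filter (fun K : Finset V => i ∈ K ∧ j ∈ K) from
        mem_filter.2 ⟨mem_univ _, hi, hj⟩)
    have h3 : (0 : ℝ) < m K := by exact_mod_cast Nat.pos_of_ne_zero hK
    linarith
  · have h1 := hS.le_diag j
    rw [coverSlack_none_some, coverSlack_diag] at h1
    have h2 : (w j : ℝ) ≤ ∑ K with j ∈ K, (m K : ℝ) := by linarith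
    exact_mod_cast h2

/-- Weak duality for stable sets. -/
theorem sum_le_of_isDualSlack (hC : Compatible G C) {S : Matrix (Option V) (Option V) ℝ}
    (hS : IsDualSlack C c S) {T : Finset V} (hT : Gᶜ.IsClique T) :
    ∑ j ∈ T, c j ≤ S none none := by
  have h0 := hS.posSemidef.dotProduct_mulVec_nonneg
    (fun i => Option.elim i 1 fun v => if v ∈ T then 1 else 0)
  have hsymm : ∀ j, S (some j) none = S none (some j) := fun j => by
    simpa using hS.posSemidef.isHermitian.apply none (some j)
  have h1 : S none none + 2 * ∑ j ∈ T, S none (some j)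
      + ∑ i ∈ T, ∑ j ∈ T, S (some i) (some j) ≥ 0 := by
    refine h0.trans_eq ?_
    simp [dotProduct, Matrix.mulVec, Fintype.sum_option, sum_add_distrib, hsymm]
    ring
  have h2 : ∑ i ∈ T, ∑ j ∈ T, S (some i) (some j) ≤ ∑ i ∈ T, S (some i) (some i) := by
    refine sum_le_sum fun i hi => ?_
    rw [← add_sum_erase T _ hi]
    have : ∑ j ∈ T.erase i, S (some i) (some j) ≤ 0 := by
      refine sum_nonpos fun j hj => ?_
      rw [mem_erase] at hj
      exact hC.nonpos i j _ hj.1.symm (hT hi hj.2 hj.1.symm).2 (hS.offDiag i j hj.1.symm)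
    linarith
  have h3 : ∑ j ∈ T, c j ≤ ∑ j ∈ T, (-2 * S none (some j) - S (some j) (some j)) :=
    sum_le_sum fun j _ => hS.le_diag j
  rw [sum_sub_distrib, ← mul_sum] at h3
  linarith

theorem _root_.Matrix.PosSemidef.sq_le {n : Type*} [Fintype n] {S : Matrix n n ℝ}
    (hS : S.PosSemidef) (i j : n) : S i j ^ 2 ≤ S i i * S j j := by
  have h := (hS.submatrix ![i, j]).det_nonneg
  rw [Matrix.det_fin_two] at h
  have hsymm : S j i = S i j := by simpa using hS.isHermitian.apply i j
  simp [hsymm] at h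
  nlinarith

/-- The dual solutions of bounded value are bounded. -/
theorem IsDualSlack.abs_apply_le {V : Type*} [Fintype V] {C : V → V → ℝ → Prop} {c : V → ℝ}
    {S : Matrix (Option V) (Option V) ℝ} (hS : IsDualSlack C c S) {M : ℝ}
    (hM : S none none ≤ M) (i j : Option V) : |S i j| ≤ 4 * M + 3 * ∑ v, |c v| := by
  set B := ∑ v, |c v| with hB
  have hB0 : 0 ≤ B := sum_nonneg fun _ _ => abs_nonneg _
  have hdiag0 : ∀ i, 0 ≤ S i i := fun i => hS.posSemidef.diag_nonneg
  have hM0 : 0 ≤ M := (hdiag0 none).trans hM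
  have hdiag : ∀ i, S i i ≤ 4 * M + 3 * B := by
    intro i
    rcases i with _ | v
    · linarith
    · have hcB : |c v| ≤ B := single_le_sum (f := fun v => |c v|)
        (fun _ _ => abs_nonneg _) (mem_univ v)
      have hc := (abs_le.1 hcB).1
      have h1 := hS.le_diag v
      have h2 := hS.posSemidef.sq_le none (some v)
      have h3 := mul_le_mul_of_nonneg_right hM (hdiag0 (some v))
      -- With `x = S none (some v)`, the `2 × 2` minor gives `x ^ 2 ≤ M * (-2 * x + B)`. Completing
      -- the square yields `x ≥ -(2 * M + B)`, and `le_diag` then bounds the diagonal entry by `4 *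
      -- M + 3 * B`.
      have h4 : M * S (some v) (some v) ≤ M * (-2 * S none (some v) + B) :=
        mul_le_mul_of_nonneg_left (by linarith) hM0
      have h5 : (S none (some v) + M) ^ 2 ≤ (M + B) ^ 2 := by nlinarith [mul_nonneg hM0 hB0]
      have h6 := (abs_le.1 (abs_le_of_sq_le_sq h5 (by linarith))).1
      linarith
  have h := hS.posSemidef.sq_le i j
  refine abs_le_of_sq_le_sq (h.trans ?_) ((hdiag0 i).trans (hdiag i))
  rw [sq]
  exact mul_le_mul (hdiag i) (hdiag j) (hdiag0 j) ((hdiag0 i).trans (hdiag i))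

theorem isClosed_isDualSlack (hC : Compatible G C) :
    IsClosed {S : Matrix (Option V) (Option V) ℝ | IsDualSlack C c S} := by
  have hset : {S : Matrix (Option V) (Option V) ℝ | IsDualSlack C c S} =
      {S | S.PosSemidef} ∩ ((⋂ j, {S | c j ≤ -2 * S none (some j) - S (some j) (some j)}) ∩
        ⋂ i, ⋂ j, {S | i ≠ j → C i j (S (some i) (some j))}) := by
    ext S
    simp only [Set.mem_inter_iff, Set.mem_iInter]
    exact ⟨fun h => ⟨h.1, h.2, h.3⟩, fun h => ⟨h.1, h.2.1, h.2.2⟩⟩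
  have hentry : ∀ i j, Continuous fun S : Matrix (Option V) (Option V) ℝ => S i j :=
    fun i j => continuous_id.matrix_elem i j
  rw [hset]
  refine IsClosed.inter ?_ (IsClosed.inter ?_ ?_)
  · have : {S : Matrix (Option V) (Option V) ℝ | S.PosSemidef} =
        {S | S.IsHermitian} ∩ ⋂ x, {S | 0 ≤ star x ⬝ᵥ (S.mulVec x)} := by
      ext S
      simp only [Set.mem_inter_iff, Set.mem_iInter]
      exact Matrix.posSemidef_iff_dotProduct_mulVec
    rw [this]
    refine IsClosed.inter (isClosed_eq ?_ continuous_id) (isClosed_iInter fun x =>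
      isClosed_le continuous_const ?_)
    · fun_prop
    · fun_prop
  · exact isClosed_iInter fun j => isClosed_le continuous_const
      ((continuous_const.mul (hentry _ _)).sub (hentry _ _))
  · refine isClosed_iInter fun i => isClosed_iInter fun j => ?_
    by_cases hij : i = j
    · simp [hij]
    · simpa [hij] using (hC.closed i j).preimage (hentry (some i) (some j))

/-- The dual program attains its infimum. -/
theorem exists_min_isDualSlack (hC : Compatible G C) (c : V → ℝ) :
    ∃ S, IsDualSlack C c S ∧ ∀ S', IsDualSlack C c S' → S none none ≤ S' none none := by
  obtain ⟨S₀, hS₀⟩ : ∃ S, IsDualSlack C c S := by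
    -- The cover by singletons with multiplicities `|c v|` is feasible. Only solutions of no larger
    -- value matter, and these lie in a compact box.
    refine ⟨coverSlack fun K => ∑ v, if K = {v} then |c v| else 0,
      isDualSlack_coverSlack hC (fun K => sum_nonneg fun v _ => ?_) (fun K hK => ?_) fun j => ?_⟩
    · split_ifs
      exacts [abs_nonneg _, le_rfl]
    · obtain ⟨v, -, hv⟩ := exists_ne_zero_of_sum_ne_zero hK
      rw [ne_eq, ite_eq_right_iff, Classical.not_imp] at hv
      simp [hv.1]
    · rw [sum_comm]
      refine le_trans ?_ (single_le_sum (fun v _ => sum_nonneg fun K _ => ?_) (mem_univ j))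
      · simp [le_abs_self]
      · split_ifs
        exacts [abs_nonneg _, le_rfl]
  set B := 4 * S₀ none none + 3 * ∑ v, |c v|
  have hcomp : IsCompact ({S : Matrix (Option V) (Option V) ℝ | IsDualSlack C c S} ∩
      Set.pi Set.univ fun _ => Set.pi Set.univ fun _ => Set.Icc (-B) B) :=
    IsCompact.inter_left (isCompact_univ_pi fun _ => isCompact_univ_pi fun _ => isCompact_Icc)
      (isClosed_isDualSlack hC)
  have hmem : ∀ {S}, IsDualSlack C c S → S none none ≤ S₀ none none →
      S ∈ ({S : Matrix (Option V) (Option V) ℝ | IsDualSlack C c S} ∩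
        Set.pi Set.univ fun _ => Set.pi Set.univ fun _ => Set.Icc (-B) B) :=
    fun hS hle => ⟨hS, fun i _ j _ => abs_le.1 (hS.abs_apply_le hle i j)⟩
  obtain ⟨S, hS, hmin⟩ := hcomp.exists_isMinOn ⟨S₀, hmem hS₀ le_rfl⟩
    (continuous_id.matrix_elem none none).continuousOn
  refine ⟨S, hS.1, fun S' hS' => ?_⟩
  rcases le_total (S' none none) (S₀ none none) with h | h
  · exact hmin (hmem hS' h)
  · exact (hmin (hmem hS₀ le_rfl)).trans h

end Slacks

/-! ### Total dual integrality against perfection. -/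

section Duality

variable {V ι : Type*} [Fintype V] [DecidableEq V] [Fintype ι]

/-- The dual solutions of the system `Sys` are given by their slacks, which are the matrices
that satisfy the entry conditions `C`. -/
structure Represents (Sys : SDPSystem V ι) (C : V → V → ℝ → Prop) : Prop where
  isDualSlack : ∀ c y, Sys.DualFeasible (diagLift c) y →
    IsDualSlack C c (Sys.slack (diagLift c) y).1
  value : ∀ c y, ∑ i, Sys.b i * y i = (Sys.slack (diagLift c) y).1 none none
  exists_dual : ∀ (c : V → ℝ) (S : SymHat V), IsDualSlack C c S.1 →
    ∃ y, (∀ i, 0 ≤ y i) ∧ Sys.slack (diagLift c) y = S ∧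
      ((∀ j, ∃ n : ℤ, c j = n) → (∀ i j, ∃ n : ℤ, S.1 i j = n) → ∀ i, ∃ n : ℤ, y i = n)

/-- The minimum size of a clique cover of the weights. -/
noncomputable def cliqueCoverNum (G : SimpleGraph V) (w : V → ℕ) : ℕ :=
  sInf {n | ∃ m, IsCliqueCover G w m ∧ ∑ K, m K = n}

variable {G : SimpleGraph V} {C : V → V → ℝ → Prop} {Sys : SDPSystem V ι}

theorem cliqueCoverNum_le {w : V → ℕ} {m : Finset V → ℕ} (hm : IsCliqueCover G w m) :
    cliqueCoverNum G w ≤ ∑ K, m K :=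
  Nat.sInf_le ⟨m, hm, rfl⟩

theorem exists_isCliqueCover (G : SimpleGraph V) (w : V → ℕ) :
    ∃ m, IsCliqueCover G w m ∧ ∑ K, m K = cliqueCoverNum G w := by
  refine Nat.sInf_mem (s := {n | ∃ m, IsCliqueCover G w m ∧ ∑ K, m K = n}) ?_
  refine ⟨_, fun K => ∑ v, if K = {v} then w v else 0, ⟨fun K hK => ?_, fun j => ?_⟩, rfl⟩
  · obtain ⟨v, -, hv⟩ := exists_ne_zero_of_sum_ne_zero hK
    rw [ne_eq, ite_eq_right_iff, Classical.not_imp] at hv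
    simp [hv.1]
  · rw [sum_comm]
    refine le_trans ?_ (single_le_sum (fun v _ => Nat.zero_le _) (mem_univ j))
    simp

/-- Only `k * f u ≤ f (k • u)` needs the hypothesis: a cover of `k • u` divided by `k` is a
fractional cover of `u`, hence a dual solution, and by `h` its value is at least the size of some
integral cover of `u`. -/
theorem isSublinear_cliqueCoverNum (hC : Compatible G C)
    (h : ∀ w : V → ℕ, ∃ m, IsCliqueCover G w m ∧
      ∀ S, IsDualSlack C (fun v => (w v : ℝ)) S → ((∑ K, m K : ℕ) : ℝ) ≤ S none none) :
    IsSublinear (cliqueCoverNum G) := by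
  refine ⟨fun u v huv => ?_, fun u v => ?_, fun k u => ?_⟩
  · obtain ⟨m, hm, hmn⟩ := exists_isCliqueCover G v
    rw [← hmn]
    exact cliqueCoverNum_le ⟨hm.1, fun j => (huv j).trans (hm.2 j)⟩
  · obtain ⟨m, hm, hmn⟩ := exists_isCliqueCover G u
    obtain ⟨m', hm', hmn'⟩ := exists_isCliqueCover G v
    rw [← hmn, ← hmn', ← sum_add_distrib]
    refine cliqueCoverNum_le (m := fun K => m K + m' K) ⟨fun K hK => ?_, fun j => ?_⟩
    · by_cases h0 : m K = 0
      · exact hm'.1 K (by simpa [h0] using hK)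
      · exact hm.1 K h0
    · rw [sum_add_distrib]
      exact add_le_add (hm.2 j) (hm'.2 j)
  · apply le_antisymm
    · obtain ⟨m, hm, hmn⟩ := exists_isCliqueCover G u
      rw [← hmn, mul_sum]
      refine cliqueCoverNum_le (m := fun K => k * m K) ⟨fun K hK => ?_, fun j => ?_⟩
      · exact hm.1 K (right_ne_zero_of_mul hK)
      · rw [← mul_sum]
        exact Nat.mul_le_mul_left k (hm.2 j)
    · rcases Nat.eq_zero_or_pos k with rfl | hk
      · simp
      obtain ⟨m, hm, hmn⟩ := exists_isCliqueCover G (k • u)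
      obtain ⟨m', hm', hle⟩ := h u
      have hk' : (0 : ℝ) < k := by exact_mod_cast hk
      have h1 := hle _ (isDualSlack_coverSlack hC (m := fun K => (m K : ℝ) / k)
        (fun K => by positivity) (fun K hK => hm.1 K fun h0 => hK (by simp [h0])) fun j => by
          rw [← sum_div, le_div_iff₀ hk']
          have := hm.2 j
          rw [Pi.smul_apply, smul_eq_mul, mul_comm] at this
          exact_mod_cast this)
      rw [coverSlack_none_none, ← sum_div, le_div_iff₀ hk', mul_comm] at h1
      have h2 : k * ∑ K, m' K ≤ ∑ K, m K := by exact_mod_cast h1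
      rw [← hmn]
      exact (Nat.mul_le_mul_left k (cliqueCoverNum_le hm')).trans h2

/-- If the clique cover number is sublinear, it is the maximum weight of a stable set. -/
theorem weightedPerfect_compl_of_isSublinear (h : IsSublinear (cliqueCoverNum G)) :
    WeightedPerfect Gᶜ := by
  intro w
  obtain ⟨g, hg, hgw⟩ := h.exists_linear w
  obtain ⟨m, hm, hmn⟩ := exists_isCliqueCover G w
  -- A clique covers its own incidence vector. So `g` takes values in `{0, 1}`, and no edge has both
  -- ends in its support.
  have hclique : ∀ K : Finset V, G.IsClique K → ∑ v ∈ K, g v ≤ 1 := by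
    intro K hK
    have h1 := (hg fun v => if v ∈ K then 1 else 0).trans (cliqueCoverNum_le
      ((isCliqueCover_zero (w := 0) fun _ => rfl).add_single hK fun v => by simp))
    rw [sum_add_single] at h1
    simpa using h1
  have hg1 : ∀ v, g v ≤ 1 := fun v => by simpa using hclique {v} (by simp)
  refine ⟨univ.filter fun v => g v = 1, fun u hu v hv huv => ?_, m, by rwa [compl_compl], ?_⟩
  · rw [SimpleGraph.compl_adj]
    refine ⟨huv, fun hadj => ?_⟩
    simp only [coe_filter, mem_univ, true_and, Set.mem_ofPred_eq] at hu hv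
    have := hclique {u, v} (by simpa [SimpleGraph.isClique_pair] using fun _ => hadj)
    rw [sum_pair huv, hu, hv] at this
    omega
  · rw [hmn, ← hgw, sum_filter]
    refine le_of_eq (sum_congr rfl fun v _ => ?_)
    have := hg1 v
    split_ifs with h1
    · rw [h1, mul_one]
    · rw [show g v = 0 by omega, mul_zero]

theorem IsPerfect.isTDIThrough (hC : Compatible G C) (hrep : Represents Sys C)
    (hG : IsPerfect G) : IsTDIThrough Sys diagLift := by
  intro c _
  obtain ⟨T, hT, m, hm, hmT⟩ := hG.weightedPerfect.compl fun v => (c v).toNat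
  rw [compl_compl] at hm
  have hsymm : (coverSlack fun K => (m K : ℝ)).transpose = coverSlack fun K => (m K : ℝ) := by
    ext i j
    simp [coverSlack_apply, mul_comm]
  have hS : IsDualSlack C (fun v => (c v : ℝ)) (coverSlack fun K => (m K : ℝ)) := by
    refine isDualSlack_coverSlack hC (fun K => Nat.cast_nonneg _)
      (fun K hK => hm.1 K (by exact_mod_cast hK)) fun j => ?_
    have h1 : c j ≤ ((∑ K with j ∈ K, m K : ℕ) : ℤ) :=
      (Int.self_le_toNat _).trans (by exact_mod_cast hm.2 j)
    exact_mod_cast h1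
  obtain ⟨y, hy0, hyS, hyint⟩ := hrep.exists_dual _ ⟨_, hsymm⟩ hS
  refine ⟨y, ⟨⟨hy0, by rw [hyS]; exact hS.posSemidef⟩, fun y' hy' => ?_⟩,
    hyint (fun j => ⟨c j, rfl⟩) fun i j => ?_, m, by rw [hyS]; rfl⟩
  · rw [hrep.value, hrep.value, hyS]
    change coverSlack _ none none ≤ _
    rw [coverSlack_none_none]
    -- The cover is matched to the truncated weights `(c v).toNat`; on the part of `T` where `c` is
    -- nonnegative these agree with `c`, and elsewhere they vanish.
    refine le_trans ?_ (sum_le_of_isDualSlack hC (hrep.isDualSlack _ _ hy')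
      (T := T.filter fun v => 0 ≤ c v) (hT.subset (coe_subset.2 (filter_subset _ _))))
    have h1 : ((∑ v ∈ T, (c v).toNat : ℕ) : ℤ) = ∑ v ∈ T with 0 ≤ c v, c v := by
      rw [sum_filter, Nat.cast_sum]
      refine sum_congr rfl fun v _ => ?_
      split_ifs with h
      · exact Int.toNat_of_nonneg h
      · rw [Int.toNat_of_nonpos (le_of_not_ge h), Nat.cast_zero]
    have h2 : ((∑ K, m K : ℕ) : ℤ) ≤ ∑ v ∈ T with 0 ≤ c v, c v := by
      rw [← h1]
      exact_mod_cast hmT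
    exact_mod_cast h2
  · have hint : ∀ (K : Finset V) i, ∃ n : ℤ, negIncid K i = n := by
      intro K i
      rcases i with _ | v
      · exact ⟨-1, by simp [negIncid]⟩
      · exact ⟨if v ∈ K then 1 else 0, by simp [negIncid]⟩
    choose n hn using hint
    refine ⟨∑ K, m K * (n K i * n K j), ?_⟩
    change coverSlack _ i j = _
    rw [coverSlack_apply]
    push_cast
    exact sum_congr rfl fun K _ => by rw [hn, hn]

theorem isPerfect_of_isTDIThrough (hC : Compatible G C) (hrep : Represents Sys C)
    (hTDI : IsTDIThrough Sys diagLift) : IsPerfect G := by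
  have hW : WeightedPerfect Gᶜ := by
    refine weightedPerfect_compl_of_isSublinear (isSublinear_cliqueCoverNum hC fun w => ?_)
    have hex : ∀ S, IsDualSlack C (fun v => (((w v : ℕ) : ℤ) : ℝ)) S →
        ∃ y, Sys.DualFeasible (diagLift fun v => (((w v : ℕ) : ℤ) : ℝ)) y ∧
          ∑ i, Sys.b i * y i = S none none := by
      intro S hS
      obtain ⟨y, hy0, hyS, -⟩ := hrep.exists_dual _ 
        ⟨S, Matrix.isHermitian_iff_isSymm.1 hS.posSemidef.isHermitian⟩ hS
      refine ⟨y, ⟨hy0, by rw [hyS]; exact hS.posSemidef⟩, ?_⟩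
      rw [hrep.value, hyS]
    obtain ⟨S, hS, hmin⟩ := exists_min_isDualSlack hC fun v => (((w v : ℕ) : ℤ) : ℝ)
    obtain ⟨y, hy, hyS⟩ := hex S hS
    obtain ⟨z, ⟨hz, hzmin⟩, -, m, hm⟩ := hTDI (fun v => (w v : ℤ)) ⟨y, hy, fun y' hy' => by
      rw [hyS, hrep.value]
      exact hmin _ (hrep.isDualSlack _ _ hy')⟩
    have hm' : (Sys.slack (diagLift fun v => (((w v : ℕ) : ℤ) : ℝ)) z).1 =
      coverSlack fun K => (m K : ℝ) := hm
    have hzS := hrep.isDualSlack _ _ hz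
    rw [hm'] at hzS
    refine ⟨m, isCliqueCover_of_isDualSlack hC (by simpa using hzS), fun S' hS' => ?_⟩
    obtain ⟨y', hy', hyS'⟩ := hex S' (by simpa using hS')
    have := hzmin y' hy'
    rw [hyS', hrep.value, hm', coverSlack_none_none] at this
    exact_mod_cast this
  have := hW.compl
  rw [compl_compl] at this
  exact this.isPerfect

theorem isTDIThrough_iff_isPerfect (hC : Compatible G C) (hrep : Represents Sys C) :
    IsTDIThrough Sys diagLift ↔ IsPerfect G :=
  ⟨isPerfect_of_isTDIThrough hC hrep, IsPerfect.isTDIThrough hC hrep⟩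

end Duality

/-! ### Slacks of the base system in coordinates. -/

section Systems

variable {V : Type*} [DecidableEq V]

theorem pairMat_none_left (p : Sym2 V) (j : Option V) : (pairMat p).1 none j = 0 := by
  induction p with
  | _ a b => simp [pairMat, twoSym, e, Matrix.vecMulVec_apply]

theorem pairMat_diag {p : Sym2 V} (hp : ¬ p.IsDiag) (j : V) :
    (pairMat p).1 (some j) (some j) = 0 := by
  induction p with
  | _ a b =>
    rw [Sym2.mk_isDiag_iff] at hp
    simp only [pairMat, Sym2.lift_mk, twoSym, Matrix.add_apply, Matrix.vecMulVec_apply, e,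
      Pi.single_apply, Option.some_inj]
    by_cases h1 : j = a <;> by_cases h2 : j = b <;> simp_all

theorem pairMat_offDiag (p : Sym2 V) {i j : V} (hij : i ≠ j) :
    (pairMat p).1 (some i) (some j) = if p = s(i, j) then 1 else 0 := by
  induction p with
  | _ a b =>
    simp only [pairMat, Sym2.lift_mk, twoSym, Matrix.add_apply, Matrix.vecMulVec_apply, e,
      Pi.single_apply, Option.some_inj, Sym2.eq_iff]
    by_cases h1 : a = i <;> by_cases h2 : b = j <;> by_cases h3 : a = j <;> by_cases h4 : b = i <;>
      simp_all [eq_comm]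

/-- A symmetric matrix with zero diagonal, row `0` and column `0`. -/
structure IsPairPart (R : SymHat V) : Prop where
  none_left : ∀ j, R.1 none j = 0
  diag : ∀ j, R.1 (some j) (some j) = 0

theorem SymHat.apply_comm {V : Type*} (R : SymHat V) (i j : Option V) : R.1 i j = R.1 j i :=
  congrFun (congrFun R.2.symm i) j

theorem SymHat.coe_sum_smul_apply {V ι : Type*} [Fintype ι] (y : ι → ℝ) (A : ι → SymHat V)
    (i j : Option V) : (∑ k, y k • A k).1 i j = ∑ k, y k * (A k).1 i j := by
  rw [Submodule.coe_sum, Matrix.sum_apply]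
  rfl

section Pairs

variable {E : Set (Sym2 V)} [Fintype E] (y : E → ℝ)

theorem isPairPart_sum (hE : ∀ p ∈ E, ¬ p.IsDiag) : IsPairPart (∑ p : E, y p • pairMat p.1) where
  none_left j := by simp [SymHat.coe_sum_smul_apply, pairMat_none_left]
  diag j := by
    rw [SymHat.coe_sum_smul_apply]
    exact sum_eq_zero fun p _ => by rw [pairMat_diag (hE p.1 p.2), mul_zero]

theorem sum_pairMat_of_mem {i j : V} (hij : i ≠ j) (h : s(i, j) ∈ E) :
    (∑ p : E, y p • pairMat p.1).1 (some i) (some j) = y ⟨s(i, j), h⟩ := by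
  rw [SymHat.coe_sum_smul_apply, sum_eq_single ⟨s(i, j), h⟩]
  · simp [pairMat_offDiag _ hij]
  · intro p _ hp
    rw [pairMat_offDiag _ hij, if_neg fun h' => hp (Subtype.ext h'), mul_zero]
  · simp

theorem sum_pairMat_of_notMem {i j : V} (hij : i ≠ j) (h : s(i, j) ∉ E) :
    (∑ p : E, y p • pairMat p.1).1 (some i) (some j) = 0 := by
  rw [SymHat.coe_sum_smul_apply]
  refine sum_eq_zero fun p _ => ?_
  rw [pairMat_offDiag _ hij, if_neg fun h' : p.1 = s(i, j) => h (h' ▸ p.2), mul_zero]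

end Pairs

variable [Fintype V]

/-- The slack of the base system, with the contribution `R` of the pairs, in coordinates. -/
theorem baseSystem_slack_apply (y : ((Unit ⊕ Unit) ⊕ (V ⊕ V)) ⊕ V → ℝ) {R : SymHat V}
    (hR : IsPairPart R) (c : V → ℝ) :
    let S := ∑ i, y i • (baseSystem V).A i + R - diagLift c
    S.1 none none = y (.inl (.inl (.inl ()))) - y (.inl (.inl (.inr ()))) ∧
    (∀ j, S.1 none (some j) = y (.inl (.inr (.inr j))) - y (.inl (.inr (.inl j)))) ∧
    (∀ j, S.1 (some j) (some j) =
      2 * (y (.inl (.inr (.inl j))) - y (.inl (.inr (.inr j)))) - y (.inr j) - c j) ∧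
    ∀ i j, i ≠ j → S.1 (some i) (some j) = R.1 (some i) (some j) := by
  have hentry : ∀ i j, (∑ i, y i • (baseSystem V).A i + R - diagLift c).1 i j =
      ∑ k, y k * ((baseSystem V).A k).1 i j + R.1 i j - (diagLift c).1 i j := by
    intro i j
    rw [← SymHat.coe_sum_smul_apply]
    rfl
  refine ⟨?_, fun j => ?_, fun j => ?_, fun i j hij => ?_⟩
  · rw [hentry, hR.none_left]
    simp [baseSystem, SDPSystem.append, SDPSystem.eq, SDPSystem.le, SDPSystem.ge, outer, twoSym, e,
      Matrix.vecMulVec_apply, diagLift]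
    ring
  · rw [hentry, hR.none_left]
    simp [baseSystem, SDPSystem.append, SDPSystem.eq, SDPSystem.le, SDPSystem.ge, outer, twoSym, e,
      Matrix.vecMulVec_apply, diagLift, Pi.single_apply]
    ring
  · rw [hentry, hR.diag]
    simp [baseSystem, SDPSystem.append, SDPSystem.eq, SDPSystem.le, SDPSystem.ge, outer, twoSym, e,
      Matrix.vecMulVec_apply, diagLift, Pi.single_apply]
    have hite : ∀ x, (if j = x then if j = x then (1 : ℝ) else 0 else 0) = if j = x then 1 else 0 :=
      fun x => by split_ifs <;> rfl
    simp only [hite]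
    simp [mul_add, sum_add_distrib]
    ring
  · rw [hentry]
    simp [baseSystem, SDPSystem.append, SDPSystem.eq, SDPSystem.le, SDPSystem.ge, outer, twoSym, e,
      Matrix.vecMulVec_apply, diagLift, Pi.single_apply, hij]
    have hite : ∀ x, (if j = x then if i = x then (1 : ℝ) else 0 else 0) = 0 := fun x => by
      by_cases h : j = x
      · rw [if_pos h, if_neg (h ▸ hij)]
      · rw [if_neg h]
    simp [hite]

theorem baseSystem_value (y : ((Unit ⊕ Unit) ⊕ (V ⊕ V)) ⊕ V → ℝ) :
    ∑ i, (baseSystem V).b i * y i = y (.inl (.inl (.inl ()))) - y (.inl (.inl (.inr ()))) := by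
  simp [baseSystem, SDPSystem.append, SDPSystem.eq, SDPSystem.le, SDPSystem.ge]
  ring

theorem max_sub_max_neg (x : ℝ) : max x 0 - max (-x) 0 = x := by
  rcases le_total 0 x with h | h
  · rw [max_eq_left h, max_eq_right (by linarith), sub_zero]
  · rw [max_eq_right h, max_eq_left (by linarith), zero_sub, neg_neg]

theorem exists_int_max {x : ℝ} (hx : ∃ n : ℤ, x = n) : ∃ n : ℤ, max x 0 = n := by
  obtain ⟨n, rfl⟩ := hx
  exact ⟨max n 0, by push_cast; rfl⟩

theorem exists_int_neg {x : ℝ} (hx : ∃ n : ℤ, x = n) : ∃ n : ℤ, -x = n := by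
  obtain ⟨n, rfl⟩ := hx
  exact ⟨-n, by push_cast; rfl⟩

/-- Every slack with the right pair entries comes from multipliers of the base system. -/
theorem exists_base_multipliers {C : V → V → ℝ → Prop} {c : V → ℝ} {S R : SymHat V}
    (hS : IsDualSlack C c S.1) (hR : IsPairPart R)
    (hRS : ∀ i j, i ≠ j → R.1 (some i) (some j) = S.1 (some i) (some j)) :
    ∃ y : ((Unit ⊕ Unit) ⊕ (V ⊕ V)) ⊕ V → ℝ, (∀ i, 0 ≤ y i) ∧
      ∑ i, y i • (baseSystem V).A i + R - diagLift c = S ∧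
      ((∀ j, ∃ n : ℤ, c j = n) → (∀ i j, ∃ n : ℤ, S.1 i j = n) → ∀ i, ∃ n : ℤ, y i = n) := by
  -- Multipliers of an equation are the positive and negative parts of an entry. They are swapped
  -- for the entries at `0j`, since `2 Sym(e_j (e_j - e_0)ᵀ)` has `-1` there. The multiplier of
  -- `⟨e_j e_jᵀ, X⟩ ≥ 0` is the gap in `le_diag`.
  refine ⟨Sum.elim (Sum.elim (Sum.elim (fun _ => max (S.1 none none) 0)
    (fun _ => max (-S.1 none none) 0)) (Sum.elim (fun j => max (-S.1 none (some j)) 0)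
      (fun j => max (S.1 none (some j)) 0)))
    fun j => -2 * S.1 none (some j) - S.1 (some j) (some j) - c j, ?_, ?_, ?_⟩
  · rintro (((_ | _) | (j | j)) | j)
    iterate 4 exact le_max_right _ _
    exact sub_nonneg.2 (hS.le_diag j)
  · obtain ⟨h00, h0, hd, ho⟩ := baseSystem_slack_apply (Sum.elim (Sum.elim (Sum.elim
      (fun _ => max (S.1 none none) 0)
      (fun _ => max (-S.1 none none) 0)) (Sum.elim (fun j => max (-S.1 none (some j)) 0)
        (fun j => max (S.1 none (some j)) 0)))
      fun j => -2 * S.1 none (some j) - S.1 (some j) (some j) - c j) hR c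
    simp only [Sum.elim_inl, Sum.elim_inr, max_sub_max_neg] at h00 h0 hd
    refine Subtype.ext (Matrix.ext fun i j => ?_)
    rcases i with _ | i <;> rcases j with _ | j
    · exact h00
    · exact h0 j
    · rw [SymHat.apply_comm, SymHat.apply_comm S (some i)]
      exact h0 i
    · by_cases hij : i = j
      · subst hij
        rw [hd]
        linarith [max_sub_max_neg (S.1 none (some i))]
      · rw [ho i j hij, hRS i j hij]
  · intro hc hint
    rintro (((_ | _) | (j | j)) | j)
    · exact exists_int_max (hint _ _)
    · exact exists_int_max (exists_int_neg (hint _ _))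
    · exact exists_int_max (exists_int_neg (hint _ _))
    · exact exists_int_max (hint _ _)
    · obtain ⟨a, ha⟩ := hint none (some j)
      obtain ⟨b, hb⟩ := hint (some j) (some j)
      obtain ⟨d, hd⟩ := hc j
      exact ⟨-2 * a - b - d, by simp [ha, hb, hd]⟩

/-- A system that adds to the base system homogeneous constraints on the pairs is represented by
the entry conditions that the multipliers of these constraints allow. -/
theorem represents_append {κ : Type*} [Fintype κ] {P : SDPSystem V κ} {C : V → V → ℝ → Prop}
    (hb : ∀ k, P.b k = 0) (hpair : ∀ y : κ → ℝ, IsPairPart (∑ k, y k • P.A k))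
    (hC : ∀ y : κ → ℝ, (∀ k, 0 ≤ y k) → ∀ i j, i ≠ j →
      C i j ((∑ k, y k • P.A k).1 (some i) (some j)))
    (hex : ∀ S : SymHat V, (∀ i j, i ≠ j → C i j (S.1 (some i) (some j))) →
      ∃ y : κ → ℝ, (∀ k, 0 ≤ y k) ∧
        (∀ i j, i ≠ j → (∑ k, y k • P.A k).1 (some i) (some j) = S.1 (some i) (some j)) ∧
        ((∀ i j, ∃ n : ℤ, S.1 i j = n) → ∀ k, ∃ n : ℤ, y k = n)) :
    Represents ((baseSystem V).append P) C := by
  have hslack : ∀ c y, ((baseSystem V).append P).slack (diagLift c) y =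
      ∑ i, y (.inl i) • (baseSystem V).A i + ∑ k, y (.inr k) • P.A k - diagLift c := by
    intro c y
    rw [SDPSystem.slack, Fintype.sum_sum_type]
    rfl
  refine ⟨fun c y hy => ⟨hy.2, fun j => ?_, fun i j hij => ?_⟩, fun c y => ?_, fun c S hS => ?_⟩
  · obtain ⟨-, h0, hd, -⟩ := baseSystem_slack_apply (fun i => y (.inl i))
      (hpair fun k => y (.inr k)) c
    rw [hslack, h0, hd]
    linarith [hy.1 (.inl (.inr j))]
  · obtain ⟨-, -, -, ho⟩ := baseSystem_slack_apply (fun i => y (.inl i))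
      (hpair fun k => y (.inr k)) c
    rw [hslack, ho i j hij]
    exact hC _ (fun k => hy.1 _) i j hij
  · obtain ⟨h00, -⟩ := baseSystem_slack_apply (fun i => y (.inl i))
      (hpair fun k => y (.inr k)) c
    rw [hslack, h00, Fintype.sum_sum_type, ← baseSystem_value fun i => y (.inl i)]
    simp [SDPSystem.append, hb]
  · obtain ⟨z, hz, hzS, hzint⟩ := hex S hS.offDiag
    obtain ⟨x, hx, hxS, hxint⟩ := exists_base_multipliers hS (hpair z) hzS
    refine ⟨Sum.elim x z, ?_, ?_, fun hc hint => ?_⟩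
    · rintro (i | k)
      exacts [hx i, hz k]
    · rw [hslack]
      exact hxS
    · rintro (i | k)
      exacts [hxint hc hint i, hzint hint k]

end Systems

/-! ### The entry conditions of the three formulations. -/

section Formulations

variable {V ι κ : Type*}

theorem SDPSystem.sum_smul_eq [Fintype ι] (A : ι → SymHat V) (b : ι → ℝ) (y : ι ⊕ ι → ℝ) :
    ∑ k, y k • (SDPSystem.eq A b).A k = ∑ i, (y (.inl i) - y (.inr i)) • A i := by
  rw [Fintype.sum_sum_type, ← sum_add_distrib]
  refine sum_congr rfl fun i _ => ?_
  change y (.inl i) • A i + y (.inr i) • -A i = _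
  module

theorem SDPSystem.sum_smul_ge [Fintype ι] (A : ι → SymHat V) (b : ι → ℝ) (y : ι → ℝ) :
    ∑ k, y k • (SDPSystem.ge A b).A k = ∑ i, (-y i) • A i := by
  refine sum_congr rfl fun i _ => ?_
  change y i • -A i = _
  module

theorem SDPSystem.sum_smul_append [Fintype ι] [Fintype κ] (S : SDPSystem V ι)
    (T : SDPSystem V κ) (y : ι ⊕ κ → ℝ) :
    ∑ k, y k • (S.append T).A k = ∑ i, y (.inl i) • S.A i + ∑ k, y (.inr k) • T.A k := by
  rw [Fintype.sum_sum_type]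
  rfl

/-- The entry of a symmetric matrix at an unordered pair. -/
def pairEntry (S : SymHat V) : Sym2 V → ℝ :=
  Sym2.lift ⟨fun i j => S.1 (some i) (some j), fun i j => SymHat.apply_comm S (some i) (some j)⟩

theorem exists_int_pairEntry {S : SymHat V} (hS : ∀ i j, ∃ n : ℤ, S.1 i j = n) (p : Sym2 V) :
    ∃ n : ℤ, pairEntry S p = n := by
  induction p with
  | _ i j => exact hS _ _

/-- Reindexing constraints is harmless. It serves to reassociate `thetaPrimeSystem` so that all pair
constraints form one block appended to the base system, as `represents_append` expects. -/
theorem Represents.of_equiv [DecidableEq V] [Fintype ι] [Fintype κ] {S : SDPSystem V ι}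
    {T : SDPSystem V κ} {C : V → V → ℝ → Prop} (f : ι ≃ κ) (hA : ∀ i, T.A (f i) = S.A i) (hb : ∀ i, T.b (f i) = S.b i)
    (h : Represents S C) : Represents T C := by
  have hslack : ∀ c y, T.slack c y = S.slack c (y ∘ f) := fun c y => by
    rw [SDPSystem.slack, SDPSystem.slack, ← f.sum_comp]
    simp [hA]
  refine ⟨fun c y hy => ?_, fun c y => ?_, fun c M hM => ?_⟩
  · rw [hslack]
    exact h.isDualSlack c _ ⟨fun i => hy.1 _, hslack (diagLift c) y ▸ hy.2⟩
  · rw [hslack, ← h.value, ← f.sum_comp]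
    simp [hb]
  · obtain ⟨y, hy, hyM, hint⟩ := h.exists_dual c M hM
    refine ⟨y ∘ f.symm, fun k => hy _, ?_, fun hc hM k => hint hc hM _⟩
    rw [hslack, ← hyM]
    congr 1
    ext i
    simp

variable (G : SimpleGraph V)

theorem compatible_theta : Compatible G fun i j s => ¬ G.Adj i j → s = 0 where
  closed i j := by
    by_cases h : G.Adj i j
    · simp [h]
    · simp only [h, not_false_eq_true, forall_const]
      exact isClosed_singleton
  zero _ _ _ := rfl
  of_adj _ _ _ h _ h' := absurd h h'
  nonpos _ _ _ _ h hs := (hs h).le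

theorem compatible_thetaPlus :
    Compatible G fun i j s => (G.Adj i j → 0 ≤ s) ∧ (¬ G.Adj i j → s = 0) where
  closed i j := by
    by_cases h : G.Adj i j
    · simp only [h, forall_const, not_true, IsEmpty.forall_iff, and_true]
      exact isClosed_Ici
    · simp only [h, not_false_eq_true, forall_const, IsEmpty.forall_iff, true_and]
      exact isClosed_singleton
  zero _ _ := ⟨fun _ => le_rfl, fun _ => rfl⟩
  of_adj _ _ _ h hs := ⟨fun _ => hs, fun h' => absurd h h'⟩
  nonpos _ _ _ _ h hs := (hs.2 h).le

theorem compatible_thetaPrime :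
    Compatible G fun i j s => ¬ G.Adj i j → s ≤ 0 where
  closed i j := by
    by_cases h : G.Adj i j
    · simp [h]
    · simp only [h, not_false_eq_true, forall_const]
      exact isClosed_Iic
  zero _ _ _ := le_rfl
  of_adj _ _ _ h _ h' := absurd h h'
  nonpos _ _ _ _ h hs := hs h

variable [Fintype V] [DecidableEq V] [DecidableRel G.Adj]

theorem represents_theta : Represents (thetaSystem G) fun i j s => ¬ G.Adj i j → s = 0 := by
  refine represents_append (by rintro (_ | _) <;> simp [SDPSystem.eq, SDPSystem.append,
    SDPSystem.le, SDPSystem.ge]) (fun y => ?_) (fun y hy i j hij hadj => ?_) fun S hS => ?_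
  · rw [SDPSystem.sum_smul_eq]
    exact isPairPart_sum _ fun p hp => G.not_isDiag_of_mem_edgeSet hp
  · rw [SDPSystem.sum_smul_eq]
    exact sum_pairMat_of_notMem _ hij hadj
  · refine ⟨Sum.elim (fun p => max (pairEntry S p.1) 0) fun p => max (-pairEntry S p.1) 0,
      ?_, fun i j hij => ?_, fun hint => ?_⟩
    · rintro (p | p) <;> exact le_max_right _ _
    · rw [SDPSystem.sum_smul_eq]
      simp only [Sum.elim_inl, Sum.elim_inr, max_sub_max_neg]
      by_cases hadj : G.Adj i j
      · exact sum_pairMat_of_mem _ hij hadj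
      · rw [hS i j hij hadj]
        exact sum_pairMat_of_notMem _ hij hadj
    · rintro (p | p)
      · exact exists_int_max (exists_int_pairEntry hint _)
      · exact exists_int_max (exists_int_neg (exists_int_pairEntry hint _))

theorem represents_thetaPlus : Represents (thetaPlusSystem G)
    fun i j s => (G.Adj i j → 0 ≤ s) ∧ (¬ G.Adj i j → s = 0) := by
  refine represents_append (fun _ => rfl)
    (fun y => isPairPart_sum _ fun p hp => G.not_isDiag_of_mem_edgeSet hp)
    (fun y hy i j hij => ⟨fun hadj => ?_, fun hadj => sum_pairMat_of_notMem _ hij hadj⟩)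
    fun S hS => ⟨fun p => pairEntry S p.1, ?_, fun i j hij => ?_,
      fun hint p => exists_int_pairEntry hint _⟩
  · exact (hy ⟨s(i, j), hadj⟩).trans_eq (sum_pairMat_of_mem y hij hadj).symm
  · rintro ⟨p, hp⟩
    induction p with
    | _ i j => exact (hS i j (G.ne_of_adj hp)).1 hp
  · by_cases hadj : G.Adj i j
    · exact sum_pairMat_of_mem _ hij hadj
    · rw [(hS i j hij).2 hadj]
      exact sum_pairMat_of_notMem _ hij hadj

theorem represents_thetaPrime : Represents (thetaPrimeSystem G)
    fun i j s => ¬ G.Adj i j → s ≤ 0 := by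
  refine Represents.of_equiv (Equiv.sumAssoc _ _ _).symm
    (S := (baseSystem V).append ((SDPSystem.eq (fun ij : G.edgeSet => pairMat ij.1)
      (fun _ => 0)).append (SDPSystem.ge (fun ij : Gᶜ.edgeSet => pairMat ij.1) (fun _ => 0))))
    (by rintro (_ | (_ | _)) <;> rfl) (by rintro (_ | (_ | _)) <;> rfl) ?_
  have hsum := fun y => (SDPSystem.sum_smul_append
    (SDPSystem.eq (fun ij : G.edgeSet => pairMat ij.1)
    (fun _ => 0)) (SDPSystem.ge (fun ij : Gᶜ.edgeSet => pairMat ij.1) (fun _ => 0)) y).trans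
      (congrArg₂ (· + ·) (SDPSystem.sum_smul_eq _ _ _) (SDPSystem.sum_smul_ge _ _ _))
  have hmem : ∀ {i j}, i ≠ j → ¬ G.Adj i j → s(i, j) ∈ Gᶜ.edgeSet := fun hij hadj =>
    (G.compl_adj _ _).2 ⟨hij, hadj⟩
  have hnotMem : ∀ {i j}, G.Adj i j → s(i, j) ∉ Gᶜ.edgeSet := fun hadj h =>
    ((G.compl_adj _ _).1 h).2 hadj
  refine represents_append (by rintro ((_ | _) | _) <;> simp [SDPSystem.eq, SDPSystem.append,
    SDPSystem.le, SDPSystem.ge]) (fun y => ?_) (fun y hy i j hij hadj => ?_) fun S hS => ?_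
  · have h1 := isPairPart_sum (fun p : G.edgeSet => y (.inl (.inl p)) - y (.inl (.inr p)))
      fun p hp => G.not_isDiag_of_mem_edgeSet hp
    have h2 := isPairPart_sum (fun p : Gᶜ.edgeSet => -y (.inr p))
      fun p hp => Gᶜ.not_isDiag_of_mem_edgeSet hp
    rw [hsum]
    exact ⟨fun j => (congrArg₂ (· + ·) (h1.none_left j) (h2.none_left j)).trans (add_zero 0),
      fun j => (congrArg₂ (· + ·) (h1.diag j) (h2.diag j)).trans (add_zero 0)⟩
  · rw [hsum]
    refine le_of_eq_of_le (congrArg₂ (· + ·) (sum_pairMat_of_notMem _ hij hadj)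
      (sum_pairMat_of_mem _ hij (hmem hij hadj))) ?_
    linarith [hy (.inr ⟨s(i, j), hmem hij hadj⟩)]
  -- Edge entries are unrestricted and split into two parts. A non-edge entry is minus the
  -- multiplier of its `≥` constraint, hence nonpositive.
  · refine ⟨Sum.elim (Sum.elim (fun p => max (pairEntry S p.1) 0)
      fun p => max (-pairEntry S p.1) 0) fun p => -pairEntry S p.1,
      ?_, fun i j hij => ?_, fun hint => ?_⟩
    · rintro ((p | p) | ⟨p, hp⟩)
      · exact le_max_right _ _
      · exact le_max_right _ _
      · induction p with
        | _ i j =>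
          exact neg_nonneg.2 (hS i j (Gᶜ.ne_of_adj hp) ((G.compl_adj _ _).1 hp).2)
    · rw [hsum]
      simp only [Sum.elim_inl, Sum.elim_inr, max_sub_max_neg, neg_neg]
      by_cases hadj : G.Adj i j
      · exact (congrArg₂ (· + ·) (sum_pairMat_of_mem _ hij hadj)
          (sum_pairMat_of_notMem _ hij (hnotMem hadj))).trans (add_zero _)
      · exact (congrArg₂ (· + ·) (sum_pairMat_of_notMem _ hij hadj)
          (sum_pairMat_of_mem _ hij (hmem hij hadj))).trans (zero_add _)
    · rintro ((p | p) | p)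
      · exact exists_int_max (exists_int_pairEntry hint _)
      · exact exists_int_max (exists_int_neg (exists_int_pairEntry hint _))
      · exact exists_int_neg (exists_int_pairEntry hint _)

end Formulations

end ThetaTDI

theorem theorem17 {V : Type*} [Fintype V] [DecidableEq V] (G : SimpleGraph V)
    [DecidableRel G.Adj] :
    (ThetaTDI.IsTDIThrough (ThetaTDI.thetaSystem G) ThetaTDI.diagLift ↔ ThetaTDI.IsPerfect G) ∧
    (ThetaTDI.IsTDIThrough (ThetaTDI.thetaPrimeSystem G) ThetaTDI.diagLift ↔
      ThetaTDI.IsPerfect G) ∧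
    (ThetaTDI.IsTDIThrough (ThetaTDI.thetaPlusSystem G) ThetaTDI.diagLift ↔
      ThetaTDI.IsPerfect G) :=
  ⟨ThetaTDI.isTDIThrough_iff_isPerfect (ThetaTDI.compatible_theta G) (ThetaTDI.represents_theta G),
    ThetaTDI.isTDIThrough_iff_isPerfect (ThetaTDI.compatible_thetaPrime G)
      (ThetaTDI.represents_thetaPrime G),
    ThetaTDI.isTDIThrough_iff_isPerfect (ThetaTDI.compatible_thetaPlus G)
      (ThetaTDI.represents_thetaPlus G)⟩
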